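/- **Theorem 2.** Let $G(s)=R(s)e^{-\tau s}$ be the open-loop transfer function of a linear feedback loop, where $R$ is a rational function with real coefficients (of any relative degree) and $\tau\ge 0$ is a dead time, and let $g=\dfrac{1}{1+G}$ be its sensitivity function, regarded as a meromorphic function. Suppose that, in the open right half-plane, $g$ has exactly the zeros $\alpha_1,\dots,\alpha_M$ and the poles $\beta_1,\dots,\beta_N$, repeated according to multiplicity ($M,N\ge 0$ finite). Let $\omega_c\ge 0$ and suppose that $$\rho=\max_{0\le\omega\le\omega_c}|g(j\omega)|\in[0,1),\qquad s_{\max}=\sup_{\omega>\omega_c}|g(j\omega)|\in(1,\infty).$$ For real $\sigma>0$ different from all $\alpha_i$ and $\beta_i$ put $$B(\sigma)=\sum_{i=1}^{M}\log\left|\frac{\sigma-\alpha_i}{\sigma+\bar\alpha_i}\right|+\sum_{i=1}^{N}\log\left|\frac{\sigma+\bar\beta_i}{\sigma-\beta_i}\right|.$$ (a) If $\sigma_k>0$ is real, different from all $\alpha_i$ and $\beta_i$, and $-\log|g(\sigma_k)|+B(\sigma_k)\le 0$, then $$\log s_{\max}\ \ge\ \frac{\left|\frac{\pi}{2}\bigl(-\log|g(\sigma_k)|+B(\sigma_k)\bigr)+\arctan\frac{\omega_c}{\sigma_k}\,\log\rho\right|}{\frac{\pi}{2}-\arctan\frac{\omega_c}{\sigma_k}}.$$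 (b) If $\sigma_k>0$ is a real zero of $G$ (a real nonminimum phase open-loop zero) and $B(\sigma_k)\le 0$, then $$\log s_{\max}\ \ge\ \frac{\left|\frac{\pi}{2}\,B(\sigma_k)+\arctan\frac{\omega_c}{\sigma_k}\,\log\rho\right|}{\frac{\pi}{2}-\arctan\frac{\omega_c}{\sigma_k}}.$$ (If $\omega_c=0$, the term $\arctan(\omega_c/\sigma_k)\log\rho$ is read as $0$, also when $\rho=0$.) -/

import Mathlib

open Complex ComplexConjugate

noncomputable section

/-- The forward-path (open-loop) transfer function `G(s) = R(s) e^{-τ s}`: a real rational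
function `R` of any relative degree, in lowest terms, and a dead time `τ`. At poles of `R` the
value is the junk value `0`. -/
def openLoop (R : RatFunc ℝ) (τ : ℝ) (s : ℂ) : ℂ :=
  Polynomial.aeval s R.num / Polynomial.aeval s R.denom * exp (-(τ * s))

/-- The sensitivity function `g = 1 / (1 + G)`, written with the denominator of `R` cleared, so
that it has its correct value `0` at the poles of `G`. At poles of `g` the value is the junk
value `0`. -/
def sensitivity (R : RatFunc ℝ) (τ : ℝ) (s : ℂ) : ℂ :=
  Polynomial.aeval s R.denom /
    (Polynomial.aeval s R.denom + Polynomial.aeval s R.num * exp (-(τ * s)))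

/-- Away from the poles of `G`, the function `sensitivity` is literally `1 / (1 + G)`. -/
theorem sensitivity_eq (R : RatFunc ℝ) (τ : ℝ) (s : ℂ)
    (hs : Polynomial.aeval s R.denom ≠ 0) :
    sensitivity R τ s = 1 / (1 + openLoop R τ s) := by
  unfold sensitivity openLoop
  rw [show 1 + Polynomial.aeval s R.num / Polynomial.aeval s R.denom * exp (-(τ * s)) =
    (Polynomial.aeval s R.denom + Polynomial.aeval s R.num * exp (-(τ * s))) /
      Polynomial.aeval s R.denom by field_simp, one_div_div]

/-- `ζ` is a nonminimum phase open-loop zero: a zero of `G` in the open right half-plane. Since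
`R.num` and `R.denom` are coprime and the exponential has no zeros, the zeros of `G` are the
roots of `R.num`. -/
def IsNMPOpenLoopZero (R : RatFunc ℝ) (ζ : ℂ) : Prop :=
  0 < ζ.re ∧ Polynomial.aeval ζ R.num = 0

/-- `α` lists the zeros and `β` the poles of `g` in the open right half-plane, each repeated
according to its multiplicity. -/
def IsRHPZeroPoleList (g : ℂ → ℂ) {M N : ℕ} (α : Fin M → ℂ) (β : Fin N → ℂ) : Prop :=
  (∀ i, 0 < (α i).re) ∧ (∀ j, 0 < (β j).re) ∧ (∀ i j, α i ≠ β j) ∧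
    ∀ z : ℂ, 0 < z.re → meromorphicOrderAt g z =
      (((Nat.card {i // α i = z} : ℤ) - (Nat.card {j // β j = z} : ℤ) : ℤ) : WithTop ℤ)

/-- The Blaschke terms `∑ log |(σ - αᵢ) / (σ + ᾱᵢ)| + ∑ log |(σ + β̄ᵢ) / (σ - βᵢ)|`. -/
def blaschkeTerms {M N : ℕ} (α : Fin M → ℂ) (β : Fin N → ℂ) (σ : ℝ) : ℝ :=
  ∑ i, Real.log ‖((σ : ℂ) - α i) / ((σ : ℂ) + conj (α i))‖ +
    ∑ j, Real.log ‖((σ : ℂ) + conj (β j)) / ((σ : ℂ) - β j)‖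

end

/-! Clear denominators: `g = D / F`, where `R = N / D` and `F = D + N e^{-τ s}`. Both `D` and `F`
are entire, have polynomial growth for `Re s ≥ 0`, and by coprimality share no zero, so the `α i`
are the zeros of `D` and the `β j` those of `F`. Reflecting each factor `s - γ` to `s + conj γ`
gives a zero- and pole-free `h = P / Q` with `|h| = |g|` on the imaginary axis and `log |h σ| = log
|g σ| - B(σ)`.

Now `log |h|` is harmonic, with boundary values at most `log ρ` on the segment of frequencies up to
`ωc` and at most `log smax` elsewhere. The harmonic measure of the segment seen from `σ` is `(2/π)
arctan (ωc / σ)`, so the two-constants theorem gives the estimate after multiplication by `π/2`. In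
(b), `g = 1` at the zero of `G`.

The difficulty is at infinity, where `h` is not known to be bounded. It is however a quotient of the
bounded functions `P / (s+1)^k` and `Q / (s+1)^k`. Hence `log |h|` has a positive harmonic majorant,
which forces growth at most linear in `Re s` (`exists_norm_le_exp_mul_re`). Since `F` is bounded
away from `0` far out on the positive real axis, `h` grows subexponentially there, and
Phragmén–Lindelöf applies. -/

/-! ### Growth and Phragmén–Lindelöf for functions of bounded type -/

open Filter Topology Metric in
/-- A harmonic function on the unit disc with a nonnegative harmonic majorant `V`, and with
nonpositive boundary values away from the point `1`, is at most a multiple of the Poisson kernel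
with pole at `1`. -/
theorem harmonic_le_poissonKernel_of_majorant {φ V : ℂ → ℝ}
    (hφ : InnerProductSpace.HarmonicOnNhd φ (ball 0 1))
    (hV : InnerProductSpace.HarmonicOnNhd V (ball 0 1))
    (hV0 : ∀ z ∈ ball (0 : ℂ) 1, 0 ≤ V z) (hφV : ∀ z ∈ ball (0 : ℂ) 1, φ z ≤ V z)
    (hbd : ∀ η > 0, ∀ δ > 0, ∃ r₀ < 1, ∀ ζ : ℂ, r₀ < ‖ζ‖ → ‖ζ‖ < 1 → δ ≤ ‖ζ - 1‖ → φ ζ ≤ η)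
    {z : ℂ} (hz : ‖z‖ < 1) :
    φ z ≤ 4 * ((1 - ‖z‖ ^ 2) / ‖1 - z‖ ^ 2) * V 0 := by
  have h1z : 0 < ‖1 - z‖ := by
    rw [norm_pos_iff, sub_ne_zero]
    rintro rfl
    simp at hz
  refine le_of_forall_pos_le_add fun η hη => ?_
  -- Split the circle of radius `r` at distance `‖1 - z‖ / 2` from `1`. On the far part `φ ≤ η`.
  -- Near `1`, the point `ζ` stays at least `‖1 - z‖ / 2` from `z`, which bounds the Poisson kernel
  -- by `K` (whence the `4`), and the mean value of `V` is `V 0`.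
  obtain ⟨r₀, hr₀, hr⟩ := hbd η hη (‖1 - z‖ / 2) (by positivity)
  obtain ⟨r, hr1, hr2⟩ := exists_between (max_lt hr₀ hz)
  have hzr : ‖z‖ < r := (le_max_right _ _).trans_lt hr1
  have hr0r : r₀ < r := (le_max_left _ _).trans_lt hr1
  have hrpos : 0 < r := (norm_nonneg z).trans_lt hzr
  have habs : |r| = r := abs_of_pos hrpos
  have hsub : closedBall (0 : ℂ) r ⊆ ball 0 1 := closedBall_subset_ball hr2
  have hzb : z ∈ ball (0 : ℂ) r := by simpa using hzr
  have hsph : ∀ ζ ∈ sphere (0 : ℂ) |r|, ‖ζ‖ = r := by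
    intro ζ hζ; simpa [habs] using hζ
  have hPcont : ContinuousOn (poissonKernel 0 z) (sphere (0 : ℂ) |r|) := by
    rw [poissonKernel_eq_re_herglotzRieszKernel]
    exact continuous_re.comp_continuousOn (continuousOn_herglotzRieszKernel_sphere hzb)
  have hsphsub : sphere (0 : ℂ) |r| ⊆ ball 0 1 := by
    rw [habs]; exact sphere_subset_closedBall.trans hsub
  have hφc : ContinuousOn φ (sphere (0 : ℂ) |r|) := hφ.continuousOn.mono hsphsub
  have hVc : ContinuousOn V (sphere (0 : ℂ) |r|) := hV.continuousOn.mono hsphsub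
  have eφ := (hφ.mono hsub).circleAverage_poissonKernel_smul hzb
  have e1 : Real.circleAverage (poissonKernel 0 z) 0 r = 1 := by
    have h := (InnerProductSpace.HarmonicOnNhd.circleAverage_poissonKernel_smul
      (f := fun _ => (1 : ℝ)) (c := 0) (R := r) (w := z)
      (fun x _ => InnerProductSpace.harmonicAt_const 1) hzb)
    rw [← h]
    congr 1
    ext x
    simp
  have eV : Real.circleAverage V 0 r = V 0 :=
    InnerProductSpace.HarmonicOnNhd.circleAverage_eq (by rw [habs]; exact hV.mono hsub)
  set K : ℝ := 4 * ((1 - ‖z‖ ^ 2) / ‖1 - z‖ ^ 2) with hK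
  have hz2 : ‖z‖ ^ 2 < 1 := by nlinarith [norm_nonneg z]
  have hint1 : CircleIntegrable (K • V) 0 r :=
    ContinuousOn.circleIntegrable' (hVc.const_smul K)
  have hint2 : CircleIntegrable (η • poissonKernel 0 z) 0 r :=
    ContinuousOn.circleIntegrable' (hPcont.const_smul η)
  have key : Real.circleAverage (poissonKernel 0 z • φ) 0 r ≤
      Real.circleAverage (K • V + η • poissonKernel 0 z) 0 r := by
    refine Real.circleAverage_mono (ContinuousOn.circleIntegrable' (hPcont.smul hφc))
      (hint1.add hint2) fun ζ hζ => ?_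
    have hnζ := hsph ζ hζ
    have hζb := hsphsub hζ
    have hP0 : 0 ≤ poissonKernel 0 z ζ := by
      rw [poissonKernel_def, sub_zero, sub_zero, hnζ]
      have : ‖z‖ ^ 2 ≤ r ^ 2 := by gcongr
      exact div_nonneg (by linarith) (by positivity)
    simp only [Pi.smul_apply', Pi.add_apply, Pi.smul_apply, smul_eq_mul]
    have hKV : 0 ≤ K * V ζ := mul_nonneg
      (by rw [hK]; exact mul_nonneg (by norm_num) (div_nonneg (by linarith) (by positivity)))
      (hV0 ζ hζb)
    by_cases hd : ‖1 - z‖ / 2 ≤ ‖ζ - 1‖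
    · have := mul_le_mul_of_nonneg_left (hr ζ (by rw [hnζ]; exact hr0r) (by rw [hnζ]; exact hr2) hd)
        hP0
      linarith
    · push Not at hd
      have hfar : ‖1 - z‖ / 2 ≤ ‖ζ - z‖ := by
        have h3 : ‖1 - z‖ ≤ ‖ζ - z‖ + ‖ζ - 1‖ := by
          calc ‖1 - z‖ = ‖(ζ - z) - (ζ - 1)‖ := by congr 1; ring
            _ ≤ _ := norm_sub_le _ _
        linarith
      have hPK : poissonKernel 0 z ζ ≤ K := by
        rw [poissonKernel_def, sub_zero, sub_zero, hnζ, hK]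
        calc (r ^ 2 - ‖z‖ ^ 2) / ‖ζ - z‖ ^ 2 ≤ (1 - ‖z‖ ^ 2) / (‖1 - z‖ / 2) ^ 2 := by
              have : r ^ 2 ≤ 1 := by nlinarith
              gcongr
          _ = 4 * ((1 - ‖z‖ ^ 2) / ‖1 - z‖ ^ 2) := by
              field_simp
              norm_num
      have h5 : poissonKernel 0 z ζ * φ ζ ≤ K * V ζ :=
        (mul_le_mul_of_nonneg_left (hφV ζ hζb) hP0).trans
          (mul_le_mul_of_nonneg_right hPK (hV0 ζ hζb))
      have := mul_nonneg hη.le hP0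
      linarith
  rw [eφ, Real.circleAverage_add hint1 hint2, Real.circleAverage_smul, Real.circleAverage_smul,
    e1, eV] at key
  simpa using key

/-- The Cayley transform maps the unit disc to the right half-plane. -/
theorem re_one_add_div_one_sub (z : ℂ) :
    ((1 + z) / (1 - z)).re = (1 - ‖z‖ ^ 2) / ‖1 - z‖ ^ 2 := by
  have := congrFun (poissonKernel_eq_re_herglotzRieszKernel (c := 0) (w := z)) 1
  simpa [poissonKernel_def, herglotzRieszKernel_def] using this.symm

open Filter Topology Metric in
/-- A zero-free holomorphic function on the right half-plane that is a quotient of bounded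
functions and is bounded by `1` on the imaginary axis grows at most exponentially in `Re s`. -/
theorem exists_norm_le_exp_mul_re {f b : ℂ → ℂ}
    (hf : DifferentiableOn ℂ f {s | 0 < s.re}) (hfc : ContinuousOn f {s | 0 ≤ s.re})
    (hf0 : ∀ s, 0 < s.re → f s ≠ 0)
    (hb : DifferentiableOn ℂ b {s | 0 < s.re}) (hb0 : ∀ s, 0 < s.re → b s ≠ 0)
    (hb1 : ∀ s, 0 < s.re → ‖b s‖ ≤ 1) (hfb : ∀ s, 0 < s.re → ‖f s‖ * ‖b s‖ ≤ 1)
    (him : ∀ s, s.re = 0 → ‖f s‖ ≤ 1) :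
    ∃ A : ℝ, ∀ s, 0 < s.re → ‖f s‖ ≤ Real.exp (A * s.re) := by
  have hopen : IsOpen {s : ℂ | 0 < s.re} := isOpen_lt continuous_const continuous_re
  set c : ℂ → ℂ := fun z => (1 + z) / (1 - z) with hc
  have hne : ∀ z ∈ ball (0 : ℂ) 1, 1 - z ≠ 0 := by
    intro z hz h
    rw [sub_eq_zero] at h
    simp [← h] at hz
  have hcre : ∀ z ∈ ball (0 : ℂ) 1, 0 < (c z).re := by
    intro z hz
    have h1 : ‖z‖ < 1 := by simpa using hz
    rw [hc]
    simp only
    rw [re_one_add_div_one_sub]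
    have := norm_pos_iff.2 (hne z hz)
    have : ‖z‖ ^ 2 < 1 := by nlinarith [norm_nonneg z]
    apply div_pos <;> [linarith; positivity]
  have hcan : ∀ z ∈ ball (0 : ℂ) 1, AnalyticAt ℂ c z := by
    intro z hz
    have := hne z hz
    rw [hc]
    fun_prop (disch := assumption)
  have hφ : InnerProductSpace.HarmonicOnNhd (fun z => Real.log ‖f (c z)‖) (ball 0 1) :=
    fun z hz => AnalyticAt.harmonicAt_log_norm (f := fun z => f (c z))
      ((hf.analyticAt (hopen.mem_nhds (hcre z hz))).fun_comp (hcan z hz)) (hf0 _ (hcre z hz))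
  have hV : InnerProductSpace.HarmonicOnNhd (fun z => Real.log ‖(b (c z))⁻¹‖) (ball 0 1) :=
    fun z hz => AnalyticAt.harmonicAt_log_norm (f := fun z => (b (c z))⁻¹)
      (((hb.analyticAt (hopen.mem_nhds (hcre z hz))).fun_comp (hcan z hz)).inv (hb0 _ (hcre z hz)))
      (inv_ne_zero (hb0 _ (hcre z hz)))
  have hbd : ∀ η > 0, ∀ δ > 0, ∃ r₀ < (1 : ℝ), ∀ ζ : ℂ, r₀ < ‖ζ‖ → ‖ζ‖ < 1 → δ ≤ ‖ζ - 1‖ →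
      Real.log ‖f (c ζ)‖ ≤ η := by
    intro η hη δ hδ
    set K : Set ℂ := closedBall 0 1 ∩ {ζ | δ ≤ ‖ζ - 1‖} with hKdef
    have hKc : IsCompact K := (isCompact_closedBall _ _).inter_right
      (isClosed_le continuous_const (by fun_prop))
    have hK1 : ∀ ζ ∈ K, 1 - ζ ≠ 0 := by
      rintro ζ ⟨-, h⟩ h0
      rw [sub_eq_zero] at h0
      simp [← h0] at h
      linarith
    have hcK : ContinuousOn c K := by
      rw [hc]
      fun_prop (disch := exact hK1)
    have hcKre : Set.MapsTo c K {s | 0 ≤ s.re} := by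
      intro ζ hζ
      have h1 : ‖ζ‖ ≤ 1 := by simpa using hζ.1
      simp only [hc, Set.mem_ofPred_eq]
      rw [re_one_add_div_one_sub]
      have : ‖ζ‖ ^ 2 ≤ 1 := by nlinarith [norm_nonneg ζ]
      exact div_nonneg (by linarith) (by positivity)
    have hFc : ContinuousOn (fun ζ => ‖f (c ζ)‖) K := (hfc.comp hcK hcKre).norm
    -- A point of largest modulus in this compact superlevel set cannot lie on the unit circle,
    -- where `‖f (c ζ)‖ ≤ 1 < exp η`; its modulus serves as `r₀`.
    set L : Set ℂ := K ∩ (fun ζ => ‖f (c ζ)‖) ⁻¹' Set.Ici (Real.exp η) with hL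
    have hLc : IsCompact L := hKc.of_isClosed_subset
      (hFc.preimage_isClosed_of_isClosed hKc.isClosed isClosed_Ici) Set.inter_subset_left
    have hfin : ∀ r₀ : ℝ, (∀ ζ ∈ L, ‖ζ‖ ≤ r₀) → ∀ ζ : ℂ, r₀ < ‖ζ‖ → ‖ζ‖ < 1 → δ ≤ ‖ζ - 1‖ →
        Real.log ‖f (c ζ)‖ ≤ η := by
      intro r₀ h ζ h1 h2 h3
      by_contra hcon
      push Not at hcon
      have hζb : ζ ∈ ball (0 : ℂ) 1 := by simpa using h2
      have hpos : 0 < ‖f (c ζ)‖ := norm_pos_iff.2 (hf0 _ (hcre ζ hζb))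
      refine absurd (h ζ ⟨⟨ball_subset_closedBall hζb, h3⟩, ?_⟩) (not_le.2 h1)
      exact ((Real.lt_log_iff_exp_lt hpos).1 hcon).le
    rcases L.eq_empty_or_nonempty with hLe | hLn
    · exact ⟨0, one_pos, hfin 0 (by simp [hLe])⟩
    · obtain ⟨ζ₀, hζ₀, hmax⟩ := hLc.exists_isMaxOn hLn continuous_norm.continuousOn
      refine ⟨‖ζ₀‖, ?_, hfin _ fun ζ hζ => hmax hζ⟩
      have hle : ‖ζ₀‖ ≤ 1 := by simpa using hζ₀.1.1
      refine lt_of_le_of_ne hle fun h1 => ?_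
      have h2 : (c ζ₀).re = 0 := by
        simp only [hc]
        rw [re_one_add_div_one_sub, h1]
        simp
      have h3 := him _ h2
      have h4 : Real.exp η ≤ ‖f (c ζ₀)‖ := hζ₀.2
      have := Real.one_lt_exp_iff.2 hη
      linarith
  have main := fun z hz => harmonic_le_poissonKernel_of_majorant hφ hV
    (fun z hz => ?_) (fun z hz => ?_) hbd (z := z) hz
  · refine ⟨4 * Real.log ‖(b (c 0))⁻¹‖, fun s hs => ?_⟩
    have hs1 : s + 1 ≠ 0 := by
      intro h
      have := congrArg re h
      simp at this
      linarith
    have h2 : (1 : ℂ) - (s - 1) / (s + 1) ≠ 0 := by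
      rw [one_sub_div hs1]
      simp [hs1]
    have hcs : c ((s - 1) / (s + 1)) = s := by
      simp only [hc]
      rw [div_eq_iff h2]
      field_simp
      ring
    have hn : ‖(s - 1) / (s + 1)‖ < 1 := by
      rw [norm_div, div_lt_one (norm_pos_iff.2 hs1), ← sq_lt_sq₀ (norm_nonneg _) (norm_nonneg _),
        ← normSq_eq_norm_sq, ← normSq_eq_norm_sq, normSq_apply, normSq_apply]
      simp
      nlinarith
    have h3 := main _ hn
    rw [hcs, ← re_one_add_div_one_sub] at h3
    have h4 := hcs
    simp only [hc] at h4
    rw [h4, Real.log_le_iff_le_exp (norm_pos_iff.2 (hf0 s hs))] at h3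
    rwa [mul_right_comm] at h3
  · have h1 := norm_pos_iff.2 (hb0 _ (hcre z hz))
    rw [norm_inv]
    exact Real.log_nonneg ((one_le_inv₀ h1).2 (hb1 _ (hcre z hz)))
  · have h1 := norm_pos_iff.2 (hb0 _ (hcre z hz))
    rw [norm_inv]
    refine Real.log_le_log (norm_pos_iff.2 (hf0 _ (hcre z hz))) ?_
    rw [← one_div, le_div_iff₀ h1]
    exact hfb _ (hcre z hz)

open Filter Topology Bornology in
/-- **Phragmén–Lindelöf principle** in the right half-plane for zero-free functions of bounded
type that grow subexponentially along the positive real axis. -/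
theorem norm_le_of_boundedType_of_subexponential {f b : ℂ → ℂ} {C K : ℝ} (hC : 0 < C)
    (hf : DifferentiableOn ℂ f {s | 0 < s.re}) (hfc : ContinuousOn f {s | 0 ≤ s.re})
    (hf0 : ∀ s, 0 < s.re → f s ≠ 0)
    (hb : DifferentiableOn ℂ b {s | 0 < s.re}) (hb0 : ∀ s, 0 < s.re → b s ≠ 0)
    (hb1 : ∀ s, 0 < s.re → ‖b s‖ ≤ K) (hfb : ∀ s, 0 < s.re → ‖f s‖ * ‖b s‖ ≤ K)
    (him : ∀ s, s.re = 0 → ‖f s‖ ≤ C)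
    (hre : ∀ ε > 0, Tendsto (fun x : ℝ => Real.exp (-ε * x) * ‖f x‖) atTop (𝓝 0))
    {s : ℂ} (hs : 0 < s.re) : ‖f s‖ ≤ C := by
  have hK : 0 < K := (norm_pos_iff.2 (hb0 1 (by simp))).trans_le (hb1 1 (by simp))
  have hCc : (C : ℂ) ≠ 0 := by exact_mod_cast hC.ne'
  -- Dividing `b` by this constant brings both `b` and `(f / C) * b` below `1`.
  have hm : 0 < max K (K / C) := lt_max_of_lt_left hK
  have hmc : ((max K (K / C) : ℝ) : ℂ) ≠ 0 := by exact_mod_cast hm.ne'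
  have nC : ‖(C : ℂ)‖ = C := by simp [abs_of_pos hC]
  have nm : ‖((max K (K / C) : ℝ) : ℂ)‖ = max K (K / C) := by
    rw [norm_real, Real.norm_eq_abs, abs_of_pos hm]
  obtain ⟨A, hA⟩ := exists_norm_le_exp_mul_re (f := fun s => f s / C)
    (b := fun s => b s / ((max K (K / C) : ℝ) : ℂ)) (hf.div_const _) (hfc.div_const _)
    (fun s hs => div_ne_zero (hf0 s hs) hCc) (hb.div_const _)
    (fun s hs => div_ne_zero (hb0 s hs) hmc)
    (fun s hs => by
      rw [norm_div, nm, div_le_one hm]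
      exact (hb1 s hs).trans (le_max_left _ _))
    (fun s hs => by
      rw [norm_div, norm_div, nC, nm, div_mul_div_comm, div_le_one (by positivity)]
      refine (hfb s hs).trans ?_
      calc K = C * (K / C) := by field_simp
        _ ≤ _ := by gcongr; exact le_max_right _ _)
    (fun s hs => by rw [norm_div, nC, div_le_one hC]; exact him s hs)
  have hA' : ∀ s : ℂ, 0 < s.re → ‖f s‖ ≤ C * Real.exp (|A| * ‖s‖) := by
    intro s hs
    have h := hA s hs
    rw [norm_div, nC, div_le_iff₀ hC, mul_comm] at h
    refine h.trans ?_
    gcongr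
    · exact le_abs_self A
    · exact (le_abs_self _).trans (abs_re_le_norm s)
  have hopen : IsOpen {s : ℂ | 0 < s.re} := isOpen_lt continuous_const continuous_re
  have hcl : closure {s : ℂ | 0 < s.re} = {s | 0 ≤ s.re} := closure_setOfPred_lt_re 0
  -- The factor `exp (-ε s)` forces decay on the real axis and has modulus `1` on the imaginary
  -- axis; then `ε → 0`.
  have step : ∀ ε > 0, Real.exp (-ε * s.re) * ‖f s‖ ≤ C := by
    intro ε hε
    have hnorm : ∀ z : ℂ, ‖exp (-ε * z) * f z‖ = Real.exp (-ε * z.re) * ‖f z‖ := by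
      intro z
      rw [norm_mul, norm_exp]
      simp
    rw [← hnorm]
    refine PhragmenLindelof.right_half_plane_of_tendsto_zero_on_real
      (f := fun z => exp (-ε * z) * f z) ?_ ⟨1, by norm_num, |A|, ?_⟩ ?_ ?_ hs.le
    · refine ⟨?_, ?_⟩
      · exact DifferentiableOn.mul (by fun_prop) hf
      · rw [hcl]
        exact ContinuousOn.mul (by fun_prop) hfc
    · refine Asymptotics.IsBigO.of_bound C ?_
      filter_upwards [mem_inf_of_right (mem_principal_self _)] with z hz
      have hz : 0 < z.re := hz
      rw [hnorm, Real.rpow_one, Real.norm_eq_abs, Real.abs_exp]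
      have h1 : Real.exp (-ε * z.re) ≤ 1 := Real.exp_le_one_iff.2 (by nlinarith)
      calc _ ≤ 1 * ‖f z‖ := by gcongr
        _ ≤ _ := by rw [one_mul]; exact hA' z hz
    · rw [tendsto_zero_iff_norm_tendsto_zero]
      refine (hre ε hε).congr fun x => ?_
      rw [hnorm, ofReal_re]
    · intro x
      rw [hnorm]
      simpa using him (x * I) (by simp)
  have hlim : Tendsto (fun ε : ℝ => Real.exp (-ε * s.re) * ‖f s‖) (𝓝[>] 0) (𝓝 ‖f s‖) := by
    refine Tendsto.mono_left ?_ nhdsWithin_le_nhds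
    exact Continuous.tendsto' (by fun_prop) _ _ (by simp)
  exact le_of_tendsto hlim (by filter_upwards [self_mem_nhdsWithin] with ε hε using step ε hε)

/-! ### The two-constants theorem -/

/-- In the right half-plane the argument is an arctangent. -/
theorem arg_eq_arctan_of_re_pos {z : ℂ} (hz : 0 < z.re) : arg z = Real.arctan (z.im / z.re) := by
  have h := abs_lt.1 (abs_arg_lt_pi_div_two_iff.2 (Or.inl hz))
  rw [← tan_arg, Real.arctan_tan h.1 h.2]

/-- The argument of a quotient of two points of the right half-plane, as an imaginary part of a
difference of logarithms: the angle under which the segment from `-i a` to `i a` is seen. -/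
theorem im_log_sub_log_of_re_pos {s : ℂ} {a δ : ℝ} (hs : 0 < s.re + δ) :
    (log (s + δ + I * a) - log (s + δ - I * a)).im =
      Real.arctan ((s.im + a) / (s.re + δ)) - Real.arctan ((s.im - a) / (s.re + δ)) := by
  rw [sub_im, log_im, log_im, arg_eq_arctan_of_re_pos (by simpa using hs),
    arg_eq_arctan_of_re_pos (by simpa using hs)]
  simp

/-- Outside the segment the angle seen from slightly to the right of the axis is small. -/
theorem arctan_sub_arctan_le_arctan {ωc κ ω : ℝ} (hκ : 0 < κ) (hω : ωc ≤ |ω|) :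
    Real.arctan ((ω + (ωc - κ)) / κ ^ 2) - Real.arctan ((ω - (ωc - κ)) / κ ^ 2) ≤
      Real.arctan κ := by
  have hinv := Real.arctan_inv_of_pos hκ
  rcases le_abs.1 hω with h | h
  · have h1 := (Real.arctan_lt_pi_div_two ((ω + (ωc - κ)) / κ ^ 2)).le
    have h2 : Real.arctan κ⁻¹ ≤ Real.arctan ((ω - (ωc - κ)) / κ ^ 2) := by
      refine Real.arctan_strictMono.monotone ?_
      rw [le_div_iff₀ (by positivity)]
      calc κ⁻¹ * κ ^ 2 = κ := by field_simp
        _ ≤ _ := by linarith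
    linarith
  · have h1 := (Real.neg_pi_div_two_lt_arctan ((ω - (ωc - κ)) / κ ^ 2)).le
    have h2 : Real.arctan ((ω + (ωc - κ)) / κ ^ 2) ≤ Real.arctan (-κ⁻¹) := by
      refine Real.arctan_strictMono.monotone ?_
      rw [div_le_iff₀ (by positivity)]
      calc _ ≤ -κ := by linarith
        _ = _ := by field_simp
    rw [Real.arctan_neg] at h2
    linarith

open Filter Topology in
/-- **Two-constants theorem** in the right half-plane for zero-free functions of bounded type that
grow subexponentially along the positive real axis. -/
theorem log_norm_le_two_constants {h b : ℂ → ℂ} {K L S ωc : ℝ} (hLS : L ≤ S)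
    (hh : DifferentiableOn ℂ h {s | 0 < s.re}) (hhc : ContinuousOn h {s | 0 ≤ s.re})
    (hh0 : ∀ s, 0 < s.re → h s ≠ 0)
    (hb : DifferentiableOn ℂ b {s | 0 < s.re}) (hb0 : ∀ s, 0 < s.re → b s ≠ 0)
    (hb1 : ∀ s, 0 < s.re → ‖b s‖ ≤ K) (hhb : ∀ s, 0 < s.re → ‖h s‖ * ‖b s‖ ≤ K)
    (hin : ∀ ω : ℝ, |ω| ≤ ωc → ‖h (I * ω)‖ ≤ Real.exp L)
    (hout : ∀ ω : ℝ, ωc < |ω| → ‖h (I * ω)‖ ≤ Real.exp S)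
    (hre : ∀ ε > 0, Tendsto (fun x : ℝ => Real.exp (-ε * x) * ‖h x‖) atTop (𝓝 0))
    {σ : ℝ} (hσ : 0 < σ) :
    Real.log ‖h σ‖ ≤ S + (L - S) / Real.pi * (2 * Real.arctan (ωc / σ)) := by
  have hπ := Real.pi_pos
  have hK : 0 < K := (norm_pos_iff.2 (hb0 1 (by simp))).trans_le (hb1 1 (by simp))
  have step : ∀ κ > 0, Real.log ‖h σ‖ ≤ (S - L) / Real.pi * Real.arctan κ +
      (S + (L - S) / Real.pi * (2 * Real.arctan ((ωc - κ) / (σ + κ ^ 2)))) := by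
    intro κ hκ
    -- The angle `A` is `π` times a harmonic measure, regularized: the shift by `κ ^ 2` keeps the
    -- logarithms off the slit up to the boundary, and shortening the segment by `κ` keeps `A ≤
    -- arctan κ` outside the original one.
    set a : ℝ := ωc - κ with ha
    have hκ2 : 0 < κ ^ 2 := by positivity
    set u : ℂ → ℂ := fun s => log (s + (κ ^ 2 : ℝ) + I * a) - log (s + (κ ^ 2 : ℝ) - I * a) with hu
    set A : ℂ → ℝ := fun s => Real.arctan ((s.im + a) / (s.re + κ ^ 2)) -
      Real.arctan ((s.im - a) / (s.re + κ ^ 2)) with hA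
    have huA : ∀ s : ℂ, 0 ≤ s.re → (u s).im = A s := fun s hs =>
      im_log_sub_log_of_re_pos (by linarith)
    have hAub : ∀ s, A s ≤ Real.pi := fun s => by
      have h1 := Real.arctan_lt_pi_div_two ((s.im + a) / (s.re + κ ^ 2))
      have h2 := Real.neg_pi_div_two_lt_arctan ((s.im - a) / (s.re + κ ^ 2))
      simp only [hA]; linarith
    have hudiff : ∀ s : ℂ, 0 ≤ s.re → DifferentiableAt ℂ u s := by
      intro s hs
      have h1 : s + (κ ^ 2 : ℝ) + I * a ∈ slitPlane := Or.inl (by simp [-ofReal_pow]; linarith)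
      have h2 : s + (κ ^ 2 : ℝ) - I * a ∈ slitPlane := Or.inl (by simp [-ofReal_pow]; linarith)
      exact DifferentiableAt.sub
        (DifferentiableAt.clog (f := fun s => s + (κ ^ 2 : ℝ) + I * a) (by fun_prop) h1)
        (DifferentiableAt.clog (f := fun s => s + (κ ^ 2 : ℝ) - I * a) (by fun_prop) h2)
    -- `‖e‖` is the exponential of minus the harmonic interpolation between `L` and `S`, so `h * e`
    -- should have modulus at most about `1` on the axis.
    set e : ℂ → ℂ := fun s => exp (-(S + ((L - S) / Real.pi : ℝ) * (-I * u s))) with he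
    have hen : ∀ s : ℂ, 0 ≤ s.re →
        ‖e s‖ = Real.exp (-S + (S - L) / Real.pi * A s) := by
      intro s hs
      rw [he]
      simp only
      rw [norm_exp, ← huA s hs]
      congr 1
      rw [neg_re, add_re, ofReal_re, re_ofReal_mul]
      simp
      ring
    have hediff : ∀ s : ℂ, 0 ≤ s.re → DifferentiableAt ℂ e s := by
      intro s hs
      have := hudiff s hs
      rw [he]
      fun_prop
    have hSL : 0 ≤ (S - L) / Real.pi := div_nonneg (by linarith) hπ.le
    have heb : ∀ s : ℂ, 0 ≤ s.re → ‖e s‖ ≤ Real.exp (-L) := by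
      intro s hs
      rw [hen s hs]
      refine Real.exp_le_exp.2 ?_
      have h1 := mul_le_mul_of_nonneg_left (hAub s) hSL
      rw [div_mul_cancel₀ _ hπ.ne'] at h1
      linarith
    set C : ℝ := Real.exp ((S - L) / Real.pi * Real.arctan κ) with hC
    have hark : 0 < Real.arctan κ := Real.arctan_pos.2 hκ
    have hC1 : 1 ≤ C := Real.one_le_exp (by positivity)
    have hbound := norm_le_of_boundedType_of_subexponential (f := fun s => h s * e s) (b := b)
      (C := C) (K := max K (K * Real.exp (-L))) (by positivity)
      (hh.mul fun s hs => (hediff s (le_of_lt hs)).differentiableWithinAt)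
      (hhc.mul fun s hs => (hediff s hs).continuousAt.continuousWithinAt)
      (fun s hs => mul_ne_zero (hh0 s hs) (exp_ne_zero _)) hb hb0
      (fun s hs => (hb1 s hs).trans (le_max_left _ _))
      (fun s hs => by
        rw [norm_mul, mul_right_comm]
        refine le_trans ?_ (le_max_right _ _)
        exact mul_le_mul (hhb s hs) (heb s hs.le) (norm_nonneg _) hK.le)
      (fun s hs => by
        have hsI : s = I * (s.im : ℝ) := by apply Complex.ext <;> simp [hs]
        rw [norm_mul, hen s hs.ge]
        rcases le_or_gt |s.im| ωc with hω | hω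
        · have h1 := hin _ hω
          rw [← hsI] at h1
          have h2 := heb s hs.ge
          rw [hen s hs.ge] at h2
          calc _ ≤ Real.exp L * Real.exp (-L) :=
                mul_le_mul h1 h2 (Real.exp_pos _).le (Real.exp_pos _).le
            _ = 1 := by rw [← Real.exp_add]; simp
            _ ≤ C := hC1
        · have h1 := hout _ hω
          rw [← hsI] at h1
          calc _ ≤ Real.exp S * Real.exp (-S + (S - L) / Real.pi * A s) := by gcongr
            _ = Real.exp ((S - L) / Real.pi * A s) := by rw [← Real.exp_add]; congr 1; ring
            _ ≤ C := by
              refine Real.exp_le_exp.2 (mul_le_mul_of_nonneg_left ?_ hSL)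
              have := arctan_sub_arctan_le_arctan hκ hω.le
              simpa [hA, hs, ha] using this)
      (fun ε hε => by
        refine squeeze_zero' (g := fun x : ℝ => Real.exp (-ε * x) * ‖h x‖ * Real.exp (-L)) ?_ ?_ ?_
        · filter_upwards with x
          positivity
        · filter_upwards [eventually_ge_atTop 0] with x hx
          rw [norm_mul, ← mul_assoc]
          gcongr
          exact heb x (by simpa using hx)
        · simpa using (hre ε hε).mul_const (Real.exp (-L)))
      (s := σ) (by simpa using hσ)
    rw [norm_mul, hen σ (by simpa using hσ.le), hC] at hbound
    have hpos : 0 < ‖h σ‖ := norm_pos_iff.2 (hh0 _ (by simpa using hσ))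
    have h3 := Real.log_le_log (by positivity) hbound
    rw [Real.log_mul hpos.ne' (Real.exp_pos _).ne', Real.log_exp, Real.log_exp] at h3
    have h4 : A σ = 2 * Real.arctan (a / (σ + κ ^ 2)) := by
      simp [hA, neg_div]
      ring
    rw [h4] at h3
    have h5 : (L - S) / Real.pi = -((S - L) / Real.pi) := by ring
    rw [h5]
    linarith
  have hlim : Tendsto (fun κ : ℝ => (S - L) / Real.pi * Real.arctan κ +
      (S + (L - S) / Real.pi * (2 * Real.arctan ((ωc - κ) / (σ + κ ^ 2))))) (𝓝[>] 0)
      (𝓝 (S + (L - S) / Real.pi * (2 * Real.arctan (ωc / σ)))) := by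
    refine Tendsto.mono_left ?_ nhdsWithin_le_nhds
    have hne : ∀ κ : ℝ, σ + κ ^ 2 ≠ 0 := fun κ => by positivity
    refine Continuous.tendsto' ?_ _ _ (by simp)
    refine (continuous_const.mul Real.continuous_arctan).add (continuous_const.add
      (continuous_const.mul (continuous_const.mul (Real.continuous_arctan.comp ?_))))
    exact Continuous.div (by fun_prop) (by fun_prop) hne
  exact ge_of_tendsto hlim (by filter_upwards [self_mem_nhdsWithin] with κ hκ using step κ hκ)

/-! ### Polynomial growth and removal of zeros -/

/-- Polynomial growth on the closed right half-plane. -/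
def HasPolyGrowth (F : ℂ → ℂ) : Prop :=
  ∃ C : ℝ, ∃ k : ℕ, ∀ s : ℂ, 0 ≤ s.re → ‖F s‖ ≤ C * ‖s + 1‖ ^ k

/-- This is why growth is measured by `s + 1`: raising the exponent only weakens the bound. -/
theorem one_le_norm_add_one {s : ℂ} (hs : 0 ≤ s.re) : 1 ≤ ‖s + 1‖ :=
  calc (1 : ℝ) ≤ (s + 1).re := by simpa using hs
    _ ≤ _ := re_le_norm _

theorem norm_le_norm_add_one {s : ℂ} (hs : 0 ≤ s.re) : ‖s‖ ≤ ‖s + 1‖ := by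
  rw [← sq_le_sq₀ (norm_nonneg _) (norm_nonneg _), ← normSq_eq_norm_sq, ← normSq_eq_norm_sq,
    normSq_apply, normSq_apply]
  simp
  nlinarith

namespace HasPolyGrowth

variable {F H : ℂ → ℂ}

theorem of_bounded {C : ℝ} (h : ∀ s : ℂ, 0 ≤ s.re → ‖F s‖ ≤ C) : HasPolyGrowth F :=
  ⟨C, 0, by simpa using h⟩

theorem const (c : ℂ) : HasPolyGrowth fun _ => c := of_bounded fun _ _ => le_rfl

theorem ident : HasPolyGrowth fun s => s :=
  ⟨1, 1, fun s hs => by simpa using norm_le_norm_add_one hs⟩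

/-- The constants in the growth bound can be enlarged. -/
theorem exists_uniform (hF : HasPolyGrowth F) (hH : HasPolyGrowth H) :
    ∃ C : ℝ, ∃ k : ℕ, 0 < C ∧ ∀ s : ℂ, 0 ≤ s.re →
      ‖F s‖ ≤ C * ‖s + 1‖ ^ k ∧ ‖H s‖ ≤ C * ‖s + 1‖ ^ k := by
  obtain ⟨C, k, h⟩ := hF
  obtain ⟨C', k', h'⟩ := hH
  have key : ∀ (c c' : ℝ) (j j' : ℕ) (s : ℂ), 0 ≤ s.re → c ≤ c' → 0 < c' → j ≤ j' →
      c * ‖s + 1‖ ^ j ≤ c' * ‖s + 1‖ ^ j' := fun c c' j j' s hs hc hc' hj => by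
    have := one_le_norm_add_one hs
    gcongr
  have hm : 0 < max 1 (max C C') := lt_max_of_lt_left one_pos
  exact ⟨max 1 (max C C'), max k k', hm, fun s hs =>
    ⟨(h s hs).trans (key _ _ _ _ s hs ((le_max_left _ _).trans (le_max_right _ _)) hm
      (le_max_left _ _)),
    (h' s hs).trans (key _ _ _ _ s hs ((le_max_right _ _).trans (le_max_right _ _)) hm
      (le_max_right _ _))⟩⟩

theorem add (hF : HasPolyGrowth F) (hH : HasPolyGrowth H) : HasPolyGrowth fun s => F s + H s := by
  obtain ⟨C, k, -, h⟩ := hF.exists_uniform hH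
  refine ⟨2 * C, k, fun s hs => (norm_add_le _ _).trans ?_⟩
  have := h s hs
  linarith [this.1, this.2]

theorem mul (hF : HasPolyGrowth F) (hH : HasPolyGrowth H) : HasPolyGrowth fun s => F s * H s := by
  obtain ⟨C, k, hC, h⟩ := hF.exists_uniform hH
  refine ⟨C * C, k + k, fun s hs => ?_⟩
  obtain ⟨h1, h2⟩ := h s hs
  calc ‖F s * H s‖ = ‖F s‖ * ‖H s‖ := norm_mul _ _
    _ ≤ (C * ‖s + 1‖ ^ k) * (C * ‖s + 1‖ ^ k) := by gcongr
    _ = _ := by ring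

theorem prod {n : ℕ} {F : Fin n → ℂ → ℂ} (h : ∀ i, HasPolyGrowth (F i)) :
    HasPolyGrowth fun s => ∏ i, F i s := by
  induction n with
  | zero => simpa using const 1
  | succ n ih =>
    simp_rw [Fin.prod_univ_succ]
    exact (h 0).mul (ih fun i => h i.succ)

theorem aeval (p : Polynomial ℝ) : HasPolyGrowth fun s => Polynomial.aeval s p := by
  induction p using Polynomial.induction_on' with
  | add p q hp hq => simpa using hp.add hq
  | monomial n a =>
    have hpow : HasPolyGrowth fun s : ℂ => s ^ n := by
      induction n with
      | zero => simpa using const 1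
      | succ n ih => simpa [pow_succ] using ih.mul ident
    simpa [Polynomial.aeval_monomial] using (const (a : ℂ)).mul hpow

/-- A continuous function has polynomial growth if its product with a linear factor has. -/
theorem of_sub_mul {γ : ℂ} (hF : Continuous F) (h : HasPolyGrowth fun s => (s - γ) * F s) :
    HasPolyGrowth F := by
  obtain ⟨C, k, h⟩ := h
  -- Near `γ` compactness bounds `F`; at distance more than `1` the linear factor only helps.
  obtain ⟨B, hB⟩ := (isCompact_closedBall γ 1).exists_bound_of_continuousOn hF.continuousOn
  obtain ⟨C', k', -, h'⟩ := exists_uniform (F := fun s => ((C * ‖s + 1‖ ^ k : ℝ) : ℂ))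
    (H := fun _ => (B : ℂ)) ⟨|C|, k, fun s _ => by simp⟩ (const _)
  refine ⟨C', k', fun s hs => ?_⟩
  obtain ⟨h1, h2⟩ := h' s hs
  rw [norm_real, Real.norm_eq_abs] at h1 h2
  by_cases hd : dist s γ ≤ 1
  · exact ((hB s hd).trans (le_abs_self _)).trans h2
  · push Not at hd
    rw [dist_eq_norm] at hd
    have h3 := h s hs
    rw [norm_mul] at h3
    refine le_trans ?_ ((h3.trans (le_abs_self _)).trans h1)
    nlinarith [norm_nonneg (F s)]

end HasPolyGrowth

/-- An entire function of polynomial growth factors through its zeros in the right half-plane. -/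
theorem exists_eq_prod_sub_mul {n : ℕ} (γ : Fin n → ℂ) {F : ℂ → ℂ} (hF : Differentiable ℂ F)
    (hg : HasPolyGrowth F) (hγ : ∀ i, 0 < (γ i).re)
    (hord : ∀ z : ℂ, 0 < z.re → analyticOrderAt F z = (Nat.card {i // γ i = z} : ℕ)) :
    ∃ F₁ : ℂ → ℂ, Differentiable ℂ F₁ ∧ HasPolyGrowth F₁ ∧
      (∀ s, F s = (∏ i, (s - γ i)) * F₁ s) ∧ ∀ s, 0 < s.re → F₁ s ≠ 0 := by
  classical
  induction n generalizing F with
  | zero =>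
    refine ⟨F, hF, hg, by simp, fun s hs => ?_⟩
    have h := hord s hs
    simp only [Nat.card_of_isEmpty, Nat.cast_zero] at h
    exact (hF.analyticAt s).analyticOrderAt_eq_zero.1 h
  | succ n ih =>
    have hcard : ∀ z, Nat.card {i // γ i = z} =
        (if γ 0 = z then 1 else 0) + Nat.card {i : Fin n // γ i.succ = z} := by
      intro z
      simp only [Nat.card_eq_fintype_card, Fintype.card_subtype, Finset.card_filter,
        Fin.sum_univ_succ]
    have h0 : F (γ 0) = 0 := by
      refine apply_eq_zero_of_analyticOrderAt_ne_zero (𝕜 := ℂ) ?_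
      rw [hord _ (hγ 0), hcard]
      simp
    -- The divided difference at a zero is entire and has order one less there.
    set F' := dslope F (γ 0) with hF'
    have hdiff : Differentiable ℂ F' := by
      rw [← differentiableOn_univ]
      exact (differentiableOn_dslope Filter.univ_mem).2 hF.differentiableOn
    have hfac : ∀ s, F s = (s - γ 0) * F' s := by
      intro s
      have := sub_smul_dslope F (γ 0) s
      rw [h0, sub_zero, smul_eq_mul] at this
      exact this.symm
    have hord' : ∀ z : ℂ, 0 < z.re →
        analyticOrderAt F' z = (Nat.card {i : Fin n // γ i.succ = z} : ℕ) := by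
      intro z hz
      have h1 := hord z hz
      have h2 : F = (fun s => s - γ 0) * F' := funext hfac
      rw [h2, analyticOrderAt_mul (by fun_prop) (hdiff.analyticAt z), hcard, Nat.cast_add] at h1
      have h3 : analyticOrderAt (fun s : ℂ => s - γ 0) z =
          ((if γ 0 = z then 1 else 0 : ℕ) : ℕ∞) := by
        split_ifs with h
        · subst h
          simp
        · simpa using analyticOrderAt_id_sub_const_of_ne (Ne.symm h)
      rw [h3] at h1
      exact (WithTop.add_left_inj (ENat.natCast_ne_top _)).1 h1
    obtain ⟨F₁, h1, h2, h3, h4⟩ := ih (fun i => γ i.succ) hdiff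
      (HasPolyGrowth.of_sub_mul (γ := γ 0) hdiff.continuous (by simpa only [← hfac] using hg))
      (fun i => hγ _) hord'
    refine ⟨F₁, h1, h2, fun s => ?_, h4⟩
    rw [hfac, h3, Fin.prod_univ_succ]
    ring

/-! ### The closed-loop characteristic function -/

/-- The characteristic function `D(s) + N(s) e^{-τ s}` of the closed loop with `R = N / D`. -/
noncomputable def closedLoopChar (R : RatFunc ℝ) (τ : ℝ) (s : ℂ) : ℂ :=
  Polynomial.aeval s R.denom + Polynomial.aeval s R.num * exp (-(τ * s))

theorem sensitivity_eq_div (R : RatFunc ℝ) (τ : ℝ) (s : ℂ) :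
    sensitivity R τ s = Polynomial.aeval s R.denom / closedLoopChar R τ s := rfl

theorem differentiable_aeval (p : Polynomial ℝ) :
    Differentiable ℂ fun s : ℂ => Polynomial.aeval s p := by
  intro s
  exact p.differentiableAt_aeval

theorem differentiable_closedLoopChar (R : RatFunc ℝ) (τ : ℝ) :
    Differentiable ℂ (closedLoopChar R τ) := by
  have h1 := differentiable_aeval R.denom
  have h2 := differentiable_aeval R.num
  unfold closedLoopChar
  fun_prop

/-- For `τ ≥ 0` the delay factor has modulus at most `1` in the closed right half-plane. -/
theorem hasPolyGrowth_closedLoopChar (R : RatFunc ℝ) {τ : ℝ} (hτ : 0 ≤ τ) :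
    HasPolyGrowth (closedLoopChar R τ) := by
  refine (HasPolyGrowth.aeval R.denom).add ((HasPolyGrowth.aeval R.num).mul
    (HasPolyGrowth.of_bounded (C := 1) fun s hs => ?_))
  rw [norm_exp, Real.exp_le_one_iff]
  simp
  positivity

theorem aeval_num_ne_zero_of_aeval_denom_eq_zero (R : RatFunc ℝ) {s : ℂ}
    (h : Polynomial.aeval s R.denom = 0) : Polynomial.aeval s R.num ≠ 0 := by
  intro h'
  obtain ⟨a, b, hab⟩ := R.isCoprime_num_denom
  have := congrArg (Polynomial.aeval s) hab
  simp [h, h'] at this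

/-- Coprimality rules out cancellation in `D / F`. -/
theorem closedLoopChar_ne_zero_of_aeval_denom_eq_zero (R : RatFunc ℝ) (τ : ℝ) {s : ℂ}
    (h : Polynomial.aeval s R.denom = 0) : closedLoopChar R τ s ≠ 0 := by
  rw [closedLoopChar, h, zero_add]
  exact mul_ne_zero (aeval_num_ne_zero_of_aeval_denom_eq_zero R h) (exp_ne_zero _)

theorem sensitivity_conj (R : RatFunc ℝ) (τ : ℝ) (s : ℂ) :
    sensitivity R τ (conj s) = conj (sensitivity R τ s) := by
  simp [sensitivity, Polynomial.aeval_conj, ← exp_conj]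

/-- Real coefficients make `|g|` even in the frequency, so bounds for `ω ≥ 0` cover the whole axis.
-/
theorem norm_sensitivity_I_mul_abs (R : RatFunc ℝ) (τ ω : ℝ) :
    ‖sensitivity R τ (I * (|ω| : ℝ))‖ = ‖sensitivity R τ (I * ω)‖ := by
  rcases abs_choice ω with h | h
  · rw [h]
  · have : I * ((|ω| : ℝ) : ℂ) = conj (I * (ω : ℂ)) := by
      rw [h]; simp
    rw [this, sensitivity_conj, norm_conj]

open Filter Topology in
theorem tendsto_exp_neg_mul_pow_norm_add_one {ε : ℝ} (hε : 0 < ε) (C : ℝ) (k : ℕ) :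
    Tendsto (fun x : ℝ => Real.exp (-ε * x) * (C * ‖(x : ℂ) + 1‖ ^ k)) atTop (𝓝 0) := by
  have h1 := (tendsto_rpow_mul_exp_neg_mul_atTop_nhds_zero k ε hε).comp
    (tendsto_atTop_add_const_right atTop (1 : ℝ) tendsto_id)
  have h2 := h1.const_mul (C * Real.exp ε)
  rw [mul_zero] at h2
  refine h2.congr' ?_
  filter_upwards [eventually_ge_atTop 0] with x hx
  have h3 : ‖(x : ℂ) + 1‖ = x + 1 := by
    rw [← ofReal_one, ← ofReal_add, norm_real, Real.norm_eq_abs, abs_of_nonneg (by linarith)]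
  have h4 : Real.exp (-ε * x) = Real.exp ε * Real.exp (-ε * (x + 1)) := by
    rw [← Real.exp_add]; congr 1; ring
  simp only [Function.comp_apply, id_eq, Real.rpow_natCast]
  rw [h3, h4]
  ring

open Filter in
theorem eventually_le_norm_aeval {p : Polynomial ℝ} (hp : p ≠ 0) :
    ∃ c > 0, ∀ᶠ x : ℝ in atTop, c ≤ ‖Polynomial.aeval (x : ℂ) p‖ := by
  have hx : ∀ x : ℝ, ‖Polynomial.aeval (x : ℂ) p‖ = |p.eval x| := by
    intro x
    have h := Polynomial.aeval_algebraMap_apply_eq_algebraMap_eval (A := ℂ) x p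
    rw [Complex.coe_algebraMap] at h
    rw [h, norm_real, Real.norm_eq_abs]
  simp_rw [hx]
  by_cases hd : 0 < p.degree
  · exact ⟨1, one_pos, (p.abs_tendsto_atTop hd).eventually_ge_atTop 1⟩
  · obtain ⟨a, rfl⟩ : ∃ a, p = Polynomial.C a :=
      ⟨_, Polynomial.eq_C_of_degree_le_zero (not_lt.1 hd)⟩
    have ha : a ≠ 0 := by rintro rfl; simp at hp
    exact ⟨|a|, abs_pos.2 ha, by simp⟩

open Filter Topology in
/-- On the positive real axis the characteristic function stays away from zero. -/
theorem eventually_le_norm_closedLoopChar (R : RatFunc ℝ) {τ : ℝ} (hτ : 0 ≤ τ)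
    (hne : ∃ s, closedLoopChar R τ s ≠ 0) :
    ∃ c > 0, ∀ᶠ x : ℝ in atTop, c ≤ ‖closedLoopChar R τ x‖ := by
  -- Without delay `F` is the nonzero polynomial `D + N`; with delay the exponential kills `N`, and
  -- `D` dominates.
  rcases hτ.eq_or_lt with rfl | hτ
  · have h : ∀ s, closedLoopChar R 0 s = Polynomial.aeval s (R.denom + R.num) := by
      intro s; simp [closedLoopChar]
    simp_rw [h]
    refine eventually_le_norm_aeval ?_
    intro h0
    obtain ⟨s, hs⟩ := hne
    simp [h, h0] at hs
  · obtain ⟨c, hc, hev⟩ := eventually_le_norm_aeval R.denom_ne_zero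
    obtain ⟨C, k, hCk⟩ := HasPolyGrowth.aeval R.num
    refine ⟨c / 2, by positivity, ?_⟩
    filter_upwards [hev, eventually_ge_atTop 0, (tendsto_exp_neg_mul_pow_norm_add_one hτ C k)
      |>.eventually_lt_const (half_pos hc)] with x h1 hx h2
    have h3 : ‖Polynomial.aeval (x : ℂ) R.num * exp (-(τ * x))‖ ≤ c / 2 := by
      rw [norm_mul, norm_exp, mul_comm]
      refine le_trans ?_ h2.le
      have h4 := hCk x (by simpa using hx)
      have h5 : (-((τ : ℂ) * x)).re = -τ * x := by simp
      rw [h5]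
      gcongr
    have h6 := norm_sub_le (closedLoopChar R τ x)
      (Polynomial.aeval (x : ℂ) R.num * exp (-(τ * x)))
    rw [closedLoopChar, add_sub_cancel_right] at h6
    rw [closedLoopChar]
    linarith

open Filter Topology in
/-- If the sensitivity is bounded on the imaginary axis, it has no poles there. -/
theorem closedLoopChar_I_mul_ne_zero (R : RatFunc ℝ) {τ : ℝ}
    (hne : ∃ s, closedLoopChar R τ s ≠ 0) {B : ℝ}
    (hB : ∀ ω : ℝ, ‖sensitivity R τ (I * ω)‖ ≤ B) (ω₀ : ℝ) : closedLoopChar R τ (I * ω₀) ≠ 0 := by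
  intro h0
  have hD0 : Polynomial.aeval (I * ω₀ : ℂ) R.denom ≠ 0 := fun h =>
    closedLoopChar_ne_zero_of_aeval_denom_eq_zero R τ h h0
  have hF := differentiable_closedLoopChar R τ
  -- At a zero of `F` the quotient has the junk value `0`, so the bound says nothing there. Zeros
  -- being isolated, `‖D‖ ≤ B ‖F‖` holds nearby and passes to the limit, contradicting `D ≠ 0`.
  have hev : ∀ᶠ s in 𝓝[≠] (I * ω₀ : ℂ), closedLoopChar R τ s ≠ 0 := by
    rcases (hF.analyticAt (I * ω₀)).eventually_eq_zero_or_eventually_ne_zero with h | h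
    · obtain ⟨s, hs⟩ := hne
      have := AnalyticOnNhd.eq_of_eventuallyEq (f := closedLoopChar R τ) (g := 0)
        (fun z _ => hF.analyticAt z) (fun z _ => analyticAt_const) h
      exact absurd (congrFun this s) hs
    · exact h
  have hmap : Tendsto (fun ω : ℝ => (I * ω : ℂ)) (𝓝[≠] ω₀) (𝓝[≠] (I * ω₀ : ℂ)) := by
    refine tendsto_nhdsWithin_of_tendsto_nhds_of_eventually_within _
      (Tendsto.mono_left (Continuous.tendsto (by fun_prop) ω₀) nhdsWithin_le_nhds) ?_
    filter_upwards [self_mem_nhdsWithin] with ω hω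
    simpa using hω
  have hle : ∀ᶠ ω : ℝ in 𝓝[≠] ω₀, ‖Polynomial.aeval (I * ω : ℂ) R.denom‖ ≤
      B * ‖closedLoopChar R τ (I * ω)‖ := by
    filter_upwards [hmap.eventually hev] with ω hω
    have := hB ω
    rwa [sensitivity_eq_div, norm_div, div_le_iff₀ (norm_pos_iff.2 hω)] at this
  have hI : Continuous fun ω : ℝ => (I * ω : ℂ) := by fun_prop
  have t1 : Tendsto (fun ω : ℝ => ‖Polynomial.aeval (I * ω : ℂ) R.denom‖) (𝓝[≠] ω₀)
      (𝓝 ‖Polynomial.aeval (I * ω₀ : ℂ) R.denom‖) :=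
    ((((differentiable_aeval R.denom).continuous.comp hI).norm).tendsto ω₀).mono_left
      nhdsWithin_le_nhds
  have t2 : Tendsto (fun ω : ℝ => B * ‖closedLoopChar R τ (I * ω)‖) (𝓝[≠] ω₀)
      (𝓝 (B * ‖closedLoopChar R τ (I * ω₀)‖)) :=
    ((continuous_const.mul (hF.continuous.comp hI).norm).tendsto ω₀).mono_left
      nhdsWithin_le_nhds
  have := le_of_tendsto_of_tendsto t1 t2 hle
  rw [h0, norm_zero, mul_zero] at this
  exact hD0 (norm_le_zero_iff.1 this)

/-- The zeros and poles of the sensitivity are the zeros of the open-loop denominator and of the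
closed-loop characteristic function. -/
theorem IsRHPZeroPoleList.analyticOrderAt_eq {R : RatFunc ℝ} {τ : ℝ} {M N : ℕ} {α : Fin M → ℂ}
    {β : Fin N → ℂ} (h : IsRHPZeroPoleList (sensitivity R τ) α β)
    (hne : ∃ s, closedLoopChar R τ s ≠ 0) {z : ℂ} (hz : 0 < z.re) :
    analyticOrderAt (fun s : ℂ => Polynomial.aeval s R.denom) z = (Nat.card {i // α i = z} : ℕ) ∧
      analyticOrderAt (closedLoopChar R τ) z = (Nat.card {j // β j = z} : ℕ) := by
  obtain ⟨-, -, hαβ, hord⟩ := h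
  have hDan := (differentiable_aeval R.denom).analyticAt z
  have hFan := (differentiable_closedLoopChar R τ).analyticAt z
  have htop : ∀ {f : ℂ → ℂ}, Differentiable ℂ f → (∃ s, f s ≠ 0) → analyticOrderAt f z ≠ ⊤ := by
    rintro f hf ⟨s, hs⟩ ht
    have := AnalyticOnNhd.eq_of_eventuallyEq (f := f) (g := 0)
      (fun z _ => hf.analyticAt z) (fun z _ => analyticAt_const) (analyticOrderAt_eq_top.1 ht)
    exact hs (congrFun this s)
  have hDne : ∃ s : ℂ, Polynomial.aeval s R.denom ≠ 0 := by
    obtain ⟨c, hc, hev⟩ := eventually_le_norm_aeval R.denom_ne_zero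
    obtain ⟨x, hx⟩ := hev.exists
    exact ⟨x, norm_pos_iff.1 (hc.trans_le hx)⟩
  obtain ⟨d, hd⟩ := ENat.ne_top_iff_exists.1 (htop (differentiable_aeval R.denom) hDne)
  obtain ⟨f, hf⟩ := ENat.ne_top_iff_exists.1 (htop (differentiable_closedLoopChar R τ) hne)
  have h1 := hord z hz
  have h2 : sensitivity R τ = (fun s : ℂ => Polynomial.aeval s R.denom) / closedLoopChar R τ := rfl
  rw [h2, meromorphicOrderAt_div hDan.meromorphicAt hFan.meromorphicAt,
    hDan.meromorphicOrderAt_eq, hFan.meromorphicOrderAt_eq, ← hd, ← hf, ENat.map_natCast,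
    ENat.map_natCast] at h1
  have h3 : (d : ℤ) - f = (Nat.card {i // α i = z} : ℤ) - (Nat.card {j // β j = z} : ℤ) := by
    exact_mod_cast h1
  -- The meromorphic order only gives the difference of the two orders. It determines both, since
  -- one order and one count vanish.
  have h4 : d = 0 ∨ f = 0 := by
    by_cases h0 : Polynomial.aeval z R.denom = 0
    · right
      have := (hFan.analyticOrderAt_eq_zero).2 (closedLoopChar_ne_zero_of_aeval_denom_eq_zero R τ h0)
      rw [← hf] at this
      exact_mod_cast this
    · left
      have := (hDan.analyticOrderAt_eq_zero).2 h0
      rw [← hd] at this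
      exact_mod_cast this
  have h5 : Nat.card {i // α i = z} = 0 ∨ Nat.card {j // β j = z} = 0 := by
    by_contra hcon
    push Not at hcon
    obtain ⟨⟨i, hi⟩⟩ := (Nat.card_ne_zero.1 hcon.1).1
    obtain ⟨⟨j, hj⟩⟩ := (Nat.card_ne_zero.1 hcon.2).1
    exact hαβ i j (hi.trans hj.symm)
  rw [← hd, ← hf]
  constructor <;> · congr 1; omega

/-! ### Blaschke reflection and the Poisson estimate -/

/-- The points `a` and `-conj a` are mirror images in the imaginary axis. -/
theorem norm_sub_eq_norm_add_conj_of_re_eq_zero {s : ℂ} (hs : s.re = 0) (a : ℂ) :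
    ‖s - a‖ = ‖s + conj a‖ := by
  have h : s + conj a = -conj (s - a) := by
    apply Complex.ext <;> simp [hs, add_comm]
  rw [h, norm_neg, norm_conj]

theorem norm_sub_le_norm_add_conj {s a : ℂ} (hs : 0 ≤ s.re) (ha : 0 ≤ a.re) :
    ‖s - a‖ ≤ ‖s + conj a‖ := by
  rw [← sq_le_sq₀ (norm_nonneg _) (norm_nonneg _), ← normSq_eq_norm_sq, ← normSq_eq_norm_sq,
    normSq_apply, normSq_apply]
  simp
  nlinarith [mul_nonneg hs ha]

theorem add_conj_ne_zero {s a : ℂ} (hs : 0 ≤ s.re) (ha : 0 < a.re) : s + conj a ≠ 0 := by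
  intro h
  have := congrArg re h
  simp at this
  linarith

/-- Replacing each factor `σ - γ` by its reflection `σ + γ̄` removes the Blaschke terms. -/
theorem log_norm_sub_blaschkeTerms {M N : ℕ} {α : Fin M → ℂ} {β : Fin N → ℂ} {σ : ℝ} (hσ : 0 < σ)
    (hα : ∀ i, 0 < (α i).re) (hβ : ∀ j, 0 < (β j).re)
    (hσα : ∀ i, (σ : ℂ) ≠ α i) (hσβ : ∀ j, (σ : ℂ) ≠ β j) {d f : ℂ} (hd : d ≠ 0) (hf : f ≠ 0) :
    Real.log ‖((∏ i, ((σ : ℂ) - α i)) * d) / ((∏ j, ((σ : ℂ) - β j)) * f)‖ -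
        blaschkeTerms α β σ =
      Real.log ‖(d * ∏ i, ((σ : ℂ) + conj (α i))) / (f * ∏ j, ((σ : ℂ) + conj (β j)))‖ := by
  have hσr : 0 < (σ : ℂ).re := by simpa using hσ
  have pα : ∀ i, 0 < ‖(σ : ℂ) - α i‖ := fun i => norm_pos_iff.2 (sub_ne_zero.2 (hσα i))
  have pβ : ∀ i, 0 < ‖(σ : ℂ) - β i‖ := fun i => norm_pos_iff.2 (sub_ne_zero.2 (hσβ i))
  have qα : ∀ i, 0 < ‖(σ : ℂ) + conj (α i)‖ := fun i =>
    norm_pos_iff.2 (add_conj_ne_zero hσr.le (hα i))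
  have qβ : ∀ i, 0 < ‖(σ : ℂ) + conj (β i)‖ := fun i =>
    norm_pos_iff.2 (add_conj_ne_zero hσr.le (hβ i))
  have pD := norm_pos_iff.2 hd
  have pF := norm_pos_iff.2 hf
  have lα : ∀ i, Real.log ‖((σ : ℂ) - α i) / ((σ : ℂ) + conj (α i))‖ =
      Real.log ‖(σ : ℂ) - α i‖ - Real.log ‖(σ : ℂ) + conj (α i)‖ := fun i => by
    rw [norm_div, Real.log_div (pα i).ne' (qα i).ne']
  have lβ : ∀ i, Real.log ‖((σ : ℂ) + conj (β i)) / ((σ : ℂ) - β i)‖ =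
      Real.log ‖(σ : ℂ) + conj (β i)‖ - Real.log ‖(σ : ℂ) - β i‖ := fun i => by
    rw [norm_div, Real.log_div (qβ i).ne' (pβ i).ne']
  have prodlog : ∀ {n : ℕ} {x : Fin n → ℝ}, (∀ i, 0 < x i) →
      0 < ∏ i, x i ∧ Real.log (∏ i, x i) = ∑ i, Real.log (x i) := fun {n x} hx =>
    ⟨Finset.prod_pos fun i _ => hx i, Real.log_prod fun i _ => (hx i).ne'⟩
  simp only [norm_div, norm_mul, norm_prod]
  rw [Real.log_div (mul_pos (prodlog pα).1 pD).ne' (mul_pos (prodlog pβ).1 pF).ne',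
    Real.log_div (mul_pos pD (prodlog qα).1).ne' (mul_pos pF (prodlog qβ).1).ne',
    Real.log_mul (prodlog pα).1.ne' pD.ne', Real.log_mul (prodlog pβ).1.ne' pF.ne',
    Real.log_mul pD.ne' (prodlog qα).1.ne', Real.log_mul pF.ne' (prodlog qβ).1.ne',
    (prodlog pα).2, (prodlog pβ).2, (prodlog qα).2, (prodlog qβ).2, blaschkeTerms]
  simp only [lα, lβ, Finset.sum_sub_distrib]
  ring

open Filter Topology in
/-- The Poisson estimate for the sensitivity function: the logarithm of its zero- and pole-free part
at a point of the positive real axis is at most the harmonic extension of its bounds on the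
imaginary axis. -/
theorem log_norm_sensitivity_sub_blaschkeTerms_le {R : RatFunc ℝ} {τ : ℝ} (hτ : 0 ≤ τ)
    {M N : ℕ} {α : Fin M → ℂ} {β : Fin N → ℂ}
    (hαβ : IsRHPZeroPoleList (sensitivity R τ) α β)
    (hne : ∃ s, closedLoopChar R τ s ≠ 0) {ωc L S : ℝ} (hLS : L ≤ S)
    (hin : ∀ ω : ℝ, |ω| ≤ ωc → ‖sensitivity R τ (I * ω)‖ ≤ Real.exp L)
    (hout : ∀ ω : ℝ, ωc < |ω| → ‖sensitivity R τ (I * ω)‖ ≤ Real.exp S)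
    {σ : ℝ} (hσ : 0 < σ) (hσα : ∀ i, (σ : ℂ) ≠ α i) (hσβ : ∀ j, (σ : ℂ) ≠ β j) :
    Real.log ‖sensitivity R τ σ‖ - blaschkeTerms α β σ ≤
      S + (L - S) / Real.pi * (2 * Real.arctan (ωc / σ)) := by
  have hB : ∀ ω : ℝ, ‖sensitivity R τ (I * ω)‖ ≤ Real.exp S := by
    intro ω
    rcases le_or_gt |ω| ωc with h | h
    · exact (hin ω h).trans (Real.exp_le_exp.2 hLS)
    · exact hout ω h
  have hFI := closedLoopChar_I_mul_ne_zero R hne hB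
  have hα := hαβ.1
  have hβ := hαβ.2.1
  obtain ⟨D₁, hD₁, gD₁, eD, nD₁⟩ := exists_eq_prod_sub_mul α (differentiable_aeval R.denom)
    (HasPolyGrowth.aeval _) hα fun z hz => (hαβ.analyticOrderAt_eq hne hz).1
  obtain ⟨F₁, hF₁, gF₁, eF, nF₁⟩ := exists_eq_prod_sub_mul β (differentiable_closedLoopChar R τ)
    (hasPolyGrowth_closedLoopChar R hτ) hβ fun z hz => (hαβ.analyticOrderAt_eq hne hz).2
  set P : ℂ → ℂ := fun s => D₁ s * ∏ i, (s + conj (α i)) with hP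
  set Q : ℂ → ℂ := fun s => F₁ s * ∏ j, (s + conj (β j)) with hQ
  have hPd : Differentiable ℂ P := by rw [hP]; fun_prop
  have hQd : Differentiable ℂ Q := by rw [hQ]; fun_prop
  have gP : HasPolyGrowth P :=
    gD₁.mul (HasPolyGrowth.prod fun i => HasPolyGrowth.ident.add (HasPolyGrowth.const _))
  have gQ : HasPolyGrowth Q :=
    gF₁.mul (HasPolyGrowth.prod fun i => HasPolyGrowth.ident.add (HasPolyGrowth.const _))
  have hsI : ∀ s : ℂ, s.re = 0 → s = I * (s.im : ℝ) := fun s hs => by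
    apply Complex.ext <;> simp [hs]
  have nF₁' : ∀ s : ℂ, 0 ≤ s.re → F₁ s ≠ 0 := by
    intro s hs
    rcases hs.eq_or_lt with h | h
    · intro h0
      have h1 := hFI s.im
      rw [← hsI s h.symm, eF, h0, mul_zero] at h1
      exact h1 rfl
    · exact nF₁ s h
  have nP : ∀ s : ℂ, 0 < s.re → P s ≠ 0 := fun s hs => mul_ne_zero (nD₁ s hs)
    (Finset.prod_ne_zero_iff.2 fun i _ => add_conj_ne_zero hs.le (hα i))
  have nQ : ∀ s : ℂ, 0 ≤ s.re → Q s ≠ 0 := fun s hs => mul_ne_zero (nF₁' s hs)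
    (Finset.prod_ne_zero_iff.2 fun i _ => add_conj_ne_zero hs (hβ i))
  obtain ⟨C, k, hC, hPQ⟩ := gP.exists_uniform gQ
  have n1 : ∀ s : ℂ, 0 ≤ s.re → s + 1 ≠ 0 := fun s hs =>
    norm_pos_iff.1 (one_pos.trans_le (one_le_norm_add_one hs))
  have haxis : ∀ ω : ℝ, ‖P (I * ω) / Q (I * ω)‖ = ‖sensitivity R τ (I * ω)‖ := by
    intro ω
    have hre : (I * ω : ℂ).re = 0 := by simp
    rw [sensitivity_eq_div, eD, eF, hP, hQ]
    simp only [norm_div, norm_mul, norm_prod, norm_sub_eq_norm_add_conj_of_re_eq_zero hre]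
    rw [mul_comm, mul_comm ‖F₁ _‖]
  have main := log_norm_le_two_constants (h := fun s => P s / Q s)
    (b := fun s => Q s / (s + 1) ^ k) (K := C) (L := L) (S := S) (ωc := ωc) hLS
    (hPd.differentiableOn.fun_div hQd.differentiableOn fun s hs => nQ s (le_of_lt hs))
    (hPd.continuous.continuousOn.div hQd.continuous.continuousOn nQ)
    (fun s hs => div_ne_zero (nP s hs) (nQ s hs.le))
    (hQd.differentiableOn.fun_div (by fun_prop) fun s hs => pow_ne_zero k (n1 s (le_of_lt hs)))
    (fun s hs => div_ne_zero (nQ s hs.le) (pow_ne_zero k (n1 s hs.le)))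
    (fun s hs => by
      have := norm_pos_iff.2 (n1 s hs.le)
      rw [norm_div, norm_pow, div_le_iff₀ (by positivity)]
      exact (hPQ s hs.le).2)
    (fun s hs => by
      have := norm_pos_iff.2 (n1 s hs.le)
      rw [← norm_mul, div_mul_div_cancel₀ (nQ s hs.le), norm_div, norm_pow,
        div_le_iff₀ (by positivity)]
      exact (hPQ s hs.le).1)
    (fun ω hω => (haxis ω).trans_le (hin ω hω))
    (fun ω hω => (haxis ω).trans_le (hout ω hω))
    (fun ε hε => by
      obtain ⟨c, hc, hev⟩ := eventually_le_norm_closedLoopChar R hτ hne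
      refine squeeze_zero' (g := fun x : ℝ => Real.exp (-ε * x) * (C / c * ‖(x : ℂ) + 1‖ ^ k))
        (by filter_upwards with x; positivity) ?_
        (tendsto_exp_neg_mul_pow_norm_add_one hε _ _)
      filter_upwards [hev, eventually_ge_atTop 0] with x hx hx0
      have hxr : 0 ≤ (x : ℂ).re := by simpa using hx0
      -- Reflecting the factors of `F` does not decrease the modulus in the right half-plane, so the
      -- lower bound for `F` passes to `Q`.
      have h1 : c ≤ ‖Q x‖ := by
        refine hx.trans ?_
        rw [eF, hQ]
        simp only [norm_mul, norm_prod]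
        rw [mul_comm]
        gcongr with j
        exact norm_sub_le_norm_add_conj hxr (hβ j).le
      have h2 : ‖P x‖ ≤ C * ‖(x : ℂ) + 1‖ ^ k := (hPQ x hxr).1
      rw [norm_div]
      gcongr
      calc ‖P x‖ / ‖Q x‖ ≤ C * ‖(x : ℂ) + 1‖ ^ k / c := by gcongr
        _ = _ := by ring)
    hσ
  refine le_trans (le_of_eq ?_) main
  rw [sensitivity_eq_div, eD, eF]
  exact log_norm_sub_blaschkeTerms hσ hα hβ hσα hσβ
    (nD₁ σ (by simpa using hσ)) (nF₁ σ (by simpa using hσ))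

/-! ### From the Poisson estimate to the theorem -/

/-- The maximum of the sensitivity over a nondegenerate frequency interval is positive. -/
theorem pos_of_isGreatest_norm_sensitivity {R : RatFunc ℝ} {τ ωc ρ : ℝ} (hωc : 0 < ωc)
    (hF : ∀ ω : ℝ, closedLoopChar R τ (I * ω) ≠ 0)
    (hρ : ρ ∈ upperBounds ((fun ω : ℝ => ‖sensitivity R τ (I * ω)‖) '' Set.Icc 0 ωc)) :
    0 < ρ := by
  by_contra hcon
  push Not at hcon
  -- If `ρ ≤ 0`, the polynomial `D` would vanish on a whole segment.
  have hroot : ∀ ω ∈ Set.Icc 0 ωc, Polynomial.aeval (I * (ω : ℝ) : ℂ) R.denom = 0 := by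
    intro ω hω
    have h1 : ‖sensitivity R τ (I * ω)‖ ≤ 0 := (hρ ⟨ω, hω, rfl⟩).trans hcon
    rw [norm_le_zero_iff, sensitivity_eq_div, div_eq_zero_iff] at h1
    exact h1.resolve_right (hF ω)
  have hinj : Function.Injective fun ω : ℝ => (I * ω : ℂ) := by
    intro x y hxy
    simpa using hxy
  have hinf : ((fun ω : ℝ => (I * ω : ℂ)) '' Set.Icc 0 ωc).Infinite :=
    (Set.Icc_infinite hωc).image hinj.injOn
  have h0 := Polynomial.eq_zero_of_infinite_isRoot (R.denom.map (algebraMap ℝ ℂ)) <|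
    hinf.mono <| by
      rintro _ ⟨ω, hω, rfl⟩
      have := hroot ω hω
      simpa [Polynomial.IsRoot, Polynomial.eval_map_algebraMap] using this
  exact R.denom_ne_zero ((Polynomial.map_eq_zero _).1 h0)

/-- The final estimate in terms of the logarithms of the bounds. -/
theorem abs_div_le_of_le {v θ l S L : ℝ} (hv : v ≤ 0) (hθ : 0 ≤ θ) (hθ' : θ < Real.pi / 2)
    (hl : l ≤ 0) (hL : θ * L = θ * l)
    (h : -v ≤ S + (L - S) / Real.pi * (2 * θ)) :
    |Real.pi / 2 * v + θ * l| / (Real.pi / 2 - θ) ≤ S := by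
  have hπ := Real.pi_pos
  -- Both summands are nonpositive, so the absolute value is just a change of sign.
  have h1 : Real.pi / 2 * v + θ * l ≤ 0 := by nlinarith
  rw [abs_of_nonpos h1, div_le_iff₀ (by linarith)]
  have h2 := mul_le_mul_of_nonneg_left h (half_pos hπ).le
  have h3 : Real.pi / 2 * (S + (L - S) / Real.pi * (2 * θ)) =
      Real.pi / 2 * S + θ * L - S * θ := by
    field_simp
    ring
  rw [h3, hL] at h2
  linarith

theorem theorem2 (R : RatFunc ℝ) (τ : ℝ) (hτ : 0 ≤ τ)
    {M N : ℕ} (α : Fin M → ℂ) (β : Fin N → ℂ)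
    (hαβ : IsRHPZeroPoleList (sensitivity R τ) α β)
    (ωc ρ smax : ℝ) (hωc : 0 ≤ ωc)
    (hρ : IsGreatest ((fun ω : ℝ => ‖sensitivity R τ (Complex.I * ω)‖) '' Set.Icc 0 ωc) ρ)
    (hρ1 : ρ < 1)
    (hsmax : IsLUB ((fun ω : ℝ => ‖sensitivity R τ (Complex.I * ω)‖) '' Set.Ioi ωc) smax)
    (hsmax1 : 1 < smax) :
    (∀ σ : ℝ, 0 < σ → (∀ i, (σ : ℂ) ≠ α i) → (∀ j, (σ : ℂ) ≠ β j) →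
      -Real.log ‖sensitivity R τ σ‖ + blaschkeTerms α β σ ≤ 0 →
      |Real.pi / 2 * (-Real.log ‖sensitivity R τ σ‖ + blaschkeTerms α β σ)
          + Real.arctan (ωc / σ) * Real.log ρ| / (Real.pi / 2 - Real.arctan (ωc / σ))
        ≤ Real.log smax) ∧
    (∀ σ : ℝ, IsNMPOpenLoopZero R σ → blaschkeTerms α β σ ≤ 0 →
      |Real.pi / 2 * blaschkeTerms α β σ + Real.arctan (ωc / σ) * Real.log ρ|
          / (Real.pi / 2 - Real.arctan (ωc / σ))
        ≤ Real.log smax) := by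
  have hρ0 : 0 ≤ ρ := by
    obtain ⟨ω, -, h⟩ := hρ.1
    rw [← h]
    exact norm_nonneg _
  have hne : ∃ s, closedLoopChar R τ s ≠ 0 := by
    by_contra hcon
    push Not at hcon
    -- If `F` vanished identically, division by zero would make the sensitivity `0` everywhere.
    have : smax ≤ 0 := hsmax.2 (by
      rintro _ ⟨ω, -, rfl⟩
      simp [sensitivity_eq_div, hcon])
    linarith
  have hin : ∀ ω : ℝ, |ω| ≤ ωc → ‖sensitivity R τ (I * ω)‖ ≤ ρ := by
    intro ω hω
    rw [← norm_sensitivity_I_mul_abs]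
    exact hρ.2 ⟨|ω|, ⟨abs_nonneg _, hω⟩, rfl⟩
  have hout : ∀ ω : ℝ, ωc < |ω| → ‖sensitivity R τ (I * ω)‖ ≤ smax := by
    intro ω hω
    rw [← norm_sensitivity_I_mul_abs]
    exact hsmax.1 ⟨|ω|, hω, rfl⟩
  have hF : ∀ ω : ℝ, closedLoopChar R τ (I * ω) ≠ 0 :=
    closedLoopChar_I_mul_ne_zero R hne (B := smax) fun ω => by
      rcases le_or_gt |ω| ωc with h | h
      · linarith [hin ω h]
      · exact hout ω h
  have hlogρ : Real.log ρ ≤ 0 := Real.log_nonpos hρ0 hρ1.le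
  have hS : 0 < Real.log smax := Real.log_pos hsmax1
  have hSe : Real.exp (Real.log smax) = smax := Real.exp_log (by linarith)
  -- For `ωc > 0` take `L = log ρ`, legitimate as `ρ > 0`. For `ωc = 0` possibly `ρ = 0`, where `exp
  -- (log ρ)` is not `ρ`; the arctangent vanishes, so `L = 0` serves.
  obtain ⟨L, hL0, hρL, hLθ⟩ : ∃ L : ℝ, L ≤ 0 ∧ ρ ≤ Real.exp L ∧
      ∀ σ : ℝ, Real.arctan (ωc / σ) * L = Real.arctan (ωc / σ) * Real.log ρ := by
    rcases hωc.eq_or_lt with h | h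
    · exact ⟨0, le_rfl, by simpa using hρ1.le, fun σ => by simp [← h]⟩
    · have hpos := pos_of_isGreatest_norm_sensitivity h hF hρ.2
      exact ⟨Real.log ρ, hlogρ, (Real.exp_log hpos).ge, fun σ => rfl⟩
  have partA : ∀ σ : ℝ, 0 < σ → (∀ i, (σ : ℂ) ≠ α i) → (∀ j, (σ : ℂ) ≠ β j) →
      -Real.log ‖sensitivity R τ σ‖ + blaschkeTerms α β σ ≤ 0 →
      |Real.pi / 2 * (-Real.log ‖sensitivity R τ σ‖ + blaschkeTerms α β σ)
          + Real.arctan (ωc / σ) * Real.log ρ| / (Real.pi / 2 - Real.arctan (ωc / σ))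
        ≤ Real.log smax := by
    intro σ hσ hσα hσβ hv
    have key := log_norm_sensitivity_sub_blaschkeTerms_le hτ hαβ hne (ωc := ωc) (L := L)
      (S := Real.log smax) (hL0.trans hS.le) (fun ω hω => (hin ω hω).trans hρL)
      (fun ω hω => (hout ω hω).trans hSe.ge) hσ hσα hσβ
    exact abs_div_le_of_le hv (Real.arctan_nonneg.2 (by positivity))
      (Real.arctan_lt_pi_div_two _) hlogρ (hLθ σ) (by linarith)
  refine ⟨partA, fun σ hσ hB => ?_⟩
  obtain ⟨hσ0, hσN⟩ := hσ
  have hD : Polynomial.aeval (σ : ℂ) R.denom ≠ 0 := fun h =>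
    aeval_num_ne_zero_of_aeval_denom_eq_zero R h hσN
  have hFD : closedLoopChar R τ σ = Polynomial.aeval (σ : ℂ) R.denom := by
    simp [closedLoopChar, hσN]
  have hg : sensitivity R τ σ = 1 := by
    rw [sensitivity_eq_div, hFD, div_self hD]
  -- At the open-loop zero `F = D ≠ 0`, so both orders are `0` and `σ` differs from every `α i` and
  -- `β j`, as (a) requires.
  obtain ⟨ordD, ordF⟩ := hαβ.analyticOrderAt_eq hne hσ0
  rw [((differentiable_aeval R.denom).analyticAt _).analyticOrderAt_eq_zero.2 hD] at ordD
  rw [((differentiable_closedLoopChar R τ).analyticAt _).analyticOrderAt_eq_zero.2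
    (by rwa [hFD])] at ordF
  have hσα : ∀ i, (σ : ℂ) ≠ α i := by
    intro i hi
    have : Nonempty {i // α i = (σ : ℂ)} := ⟨⟨i, hi.symm⟩⟩
    exact Nat.card_pos.ne (by exact_mod_cast ordD)
  have hσβ : ∀ j, (σ : ℂ) ≠ β j := by
    intro j hj
    have : Nonempty {j // β j = (σ : ℂ)} := ⟨⟨j, hj.symm⟩⟩
    exact Nat.card_pos.ne (by exact_mod_cast ordF)
  simpa [hg] using partA σ (by simpa using hσ0) hσα hσβ (by simpa [hg] using hB)
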